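/- Let $R$ be a commutative Noetherian ring and let $\operatorname{mod} R$ be the category of finitely generated $R$-modules. For $G\in\operatorname{mod}R$, define full subcategories $\operatorname{thick}^n(G)$ and $|G|_n$ ($n\ge 0$) of $\operatorname{mod}R$ as follows. Both $\operatorname{thick}^0(G)$ and $|G|_0$ consist of the zero modules, and both $\operatorname{thick}^1(G)$ and $|G|_1$ consist of the direct summands of finite direct sums of copies of $G$. For $n\ge2$, $\operatorname{thick}^n(G)$ consists of the direct summands of those finitely generated modules that occur, in any of the three positions, in a short exact sequence of finitely generated modules in which one of the two remaining terms lies in $\operatorname{thick}^{n-1}(G)$ and the other in $\operatorname{thick}^1(G)$. For $n\ge2$, $|G|_n$ consists of the $Y$ for which there are a finitely generated module $Y'$ and a short exact sequence $0\to Y_1\to Y\oplus Y'\to Y_2\to0$ with $Y_1\in|G|_{n-1}$ and $Y_2\in|G|_1$. The module $G$ is a *strong generator* of $\operatorname{mod}R$ if $\operatorname{thick}^n(G)=\operatorname{mod}R$ for some $n\ge0$. It is an *extension generator* of $\operatorname{mod}R$ if there is $s\ge0$ such that every $X\in\operatorname{mod}R$ has an $s$-th syzygy $\Omega^s_R(X)$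 lying in $\bigcup_{t\ge0}|G|_t$. Here an $s$-th syzygy of $X$ is a module $K$ in an exact sequence $0\to K\to P_{s-1}\to\cdots\to P_0\to X\to0$ with all $P_i$ finitely generated projective (and $K\cong X$ if $s=0$). For an $R$-module $M$, put $$\operatorname{IID}(M)=\{\mathfrak p\in\operatorname{Spec}R : \operatorname{inj.dim}_{R_{\mathfrak p}}(M_{\mathfrak p})=\infty\},$$ and let $\operatorname{coca}_R(M)=\bigcup_{n\ge0}\operatorname{coca}^n_R(M)$, where $\operatorname{coca}^n_R(M)$ is the ideal of all $r\in R$ with $r\cdot\operatorname{Ext}^i_R(N,M)=0$ for all $i\ge n$ and all $N\in\operatorname{mod}R$. **Theorem.** Let $M$ be a finitely generated $R$-module. 1. If $\operatorname{mod}R$ has an extension generator, then $\operatorname{IID}(M)$ is closed in $\operatorname{Spec}R$. Moreover, for every extension generator $G$ of $\operatorname{mod}R$, $$\operatorname{IID}(M)=\bigcap_{n>0}\operatorname{Supp}_R\operatorname{Ext}^n_R(G,M).$$ 2. If $\operatorname{mod}R$ has a strong generator, then $\operatorname{IID}(M)=V(\operatorname{coca}_R(M))$, where $V(I)$ denotes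 the set of prime ideals containing $I$. -/

import Mathlib

universe v u

namespace CategoryTheory

open Limits

section Building

attribute [local instance] Abelian.hasFiniteBiproducts

variable {C : Type u} [Category.{v} C] [Abelian C]

/-- `Y` is a direct summand of a finite direct sum of copies of `X`
(in an abelian category, the direct summands of an object are its retracts). -/
def addClosure (X : C) : ObjectProperty C := fun Y =>
  ∃ k : ℕ, Nonempty (Retract Y (⨁ fun _ : Fin k => X))

/-- One of the objects `A`, `B` satisfies `P` and the other one satisfies `Q`. -/
def OneInEach (P Q : ObjectProperty C) (A B : C) : Prop :=
  (P A ∧ Q B) ∨ (Q A ∧ P B)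

/-- The full subcategories `thickⁿ(X)` of an abelian category: `thick⁰(X)` consists of the zero
objects, `thick¹(X)` of the direct summands of finite direct sums of copies of `X`, and, for
`n ≥ 2`, `thickⁿ(X)` consists of the direct summands of the objects that occur (in any of the
three positions) in a short exact sequence whose other two terms lie
one in `thickⁿ⁻¹(X)` and the other in `thick¹(X)`. -/
def thickLevel (X : C) : ℕ → ObjectProperty C
  | 0 => fun Y => IsZero Y
  | 1 => addClosure X
  | n + 2 => fun Y => ∃ S : ShortComplex C, S.ShortExact ∧
      ((Nonempty (Retract Y S.X₁) ∧ OneInEach (thickLevel X (n + 1)) (addClosure X) S.X₂ S.X₃) ∨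
       (Nonempty (Retract Y S.X₂) ∧ OneInEach (thickLevel X (n + 1)) (addClosure X) S.X₁ S.X₃) ∨
       (Nonempty (Retract Y S.X₃) ∧ OneInEach (thickLevel X (n + 1)) (addClosure X) S.X₁ S.X₂))

/-- `G` is a strong generator of the abelian category `C`: `thickⁿ(G) = C` for some `n`. -/
def IsAbelianStrongGenerator (G : C) : Prop :=
  ∃ n : ℕ, ∀ Y : C, thickLevel G n Y

/-- The full subcategories `|X|ₙ`: `|X|₀` consists of the zero objects, `|X|₁` of the direct
summands of finite direct sums of copies of `X`, and, for `n ≥ 2`, `|X|ₙ` consists of the `Y`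
such that there is a short exact sequence `0 ⟶ Y₁ ⟶ Y ⊕ Y' ⟶ Y₂ ⟶ 0` with `Y₁` in `|X|ₙ₋₁`
and `Y₂` in `|X|₁`. -/
def extLevel (X : C) : ℕ → ObjectProperty C
  | 0 => fun Y => IsZero Y
  | 1 => addClosure X
  | n + 2 => fun Y => ∃ S : ShortComplex C, S.ShortExact ∧
      extLevel X (n + 1) S.X₁ ∧ Nonempty (Retract Y S.X₂) ∧ addClosure X S.X₃

end Building

end CategoryTheory

section Modules

open CategoryTheory Abelian

/-- `K` is an `n`-th syzygy of the finitely generated module `X`: there is an exact sequence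
`0 → K → Pₙ₋₁ → ⋯ → P₀ → X → 0` with all `Pᵢ` finitely generated projective (and `K ≅ X` if
`n = 0`). It is split here into short exact sequences. -/
def FGModuleCat.IsSyzygy {R : Type u} [CommRing R] [IsNoetherianRing R] :
    ℕ → FGModuleCat.{u} R → FGModuleCat.{u} R → Prop
  | 0, X, K => Nonempty (X ≅ K)
  | n + 1, X, K => ∃ S : ShortComplex (FGModuleCat.{u} R), S.ShortExact ∧
      Nonempty (S.X₃ ≅ X) ∧ Module.Projective R S.X₂ ∧ FGModuleCat.IsSyzygy n S.X₁ K

/-- `G` is an extension generator of `mod R`: there is `s ≥ 0` such that the `s`-th syzygy of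
every finitely generated module lies in `⋃ₜ |G|ₜ`. Syzygies are determined only up to projective
summands; it is enough that one representative lies in the union. -/
def FGModuleCat.IsExtensionGenerator {R : Type u} [CommRing R] [IsNoetherianRing R]
    (G : FGModuleCat.{u} R) : Prop :=
  ∃ s : ℕ, ∀ X : FGModuleCat.{u} R, ∃ K : FGModuleCat.{u} R,
    FGModuleCat.IsSyzygy s X K ∧ ∃ t : ℕ, extLevel G t K

variable (R : Type u) [CommRing R]

/-- The infinite injective dimension locus: the primes `𝔭` with `id (M_𝔭) = ∞` over `R_𝔭`. -/
def infiniteInjDimLocus (M : Type u) [AddCommGroup M] [Module R M] : Set (PrimeSpectrum R) :=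
  {p | injectiveDimension (ModuleCat.of.{u} (Localization.AtPrime p.asIdeal)
    (LocalizedModule.AtPrime p.asIdeal M)) = ⊤}

/-- The `n`-th co-cohomological annihilator: the ideal of all `r` such that `r` annihilates
`Extⁱ_R(N, M)` for all `i ≥ n` and all finitely generated `N`. -/
noncomputable def cocaLevel (M : Type u) [AddCommGroup M] [Module R M] (n : ℕ) : Ideal R where
  carrier := {r | ∀ i : ℕ, n ≤ i → ∀ N : FGModuleCat.{u} R,
    ∀ e : Ext.{u} N.obj (ModuleCat.of R M) i, r • e = 0}
  zero_mem' := fun i _ N e => zero_smul R e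
  add_mem' := fun {a b} ha hb i hi N e => by rw [add_smul, ha i hi N e, hb i hi N e, add_zero]
  smul_mem' := fun c r hr i hi N e => by rw [smul_eq_mul, mul_smul, hr i hi N e, smul_zero]

theorem cocaLevel_mono (M : Type u) [AddCommGroup M] [Module R M] {m n : ℕ} (h : m ≤ n) :
    cocaLevel R M m ≤ cocaLevel R M n :=
  fun _ hr i hi N e => hr i (h.trans hi) N e

/-- The co-cohomological annihilator: the union of the ascending chain of the ideals
`cocaLevel R M n`. -/
noncomputable def coca (M : Type u) [AddCommGroup M] [Module R M] : Ideal R :=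
  ⨆ n : ℕ, cocaLevel R M n

theorem mem_coca (M : Type u) [AddCommGroup M] [Module R M] (r : R) :
    r ∈ coca R M ↔ ∃ n : ℕ, r ∈ cocaLevel R M n :=
  Submodule.mem_iSup_of_directed _
    (monotone_nat_of_le_succ fun n => cocaLevel_mono R M n.le_succ).directed_le

end Modules

-- For finitely generated `X` over a Noetherian ring, `Ext(X, M)` commutes with localization
-- (`exists_smul_eq_zero_and_exists_smul_eq_mapExactFunctor`). With Baer's criterion, a prime 𝔭 lies
-- outside the locus as soon as, in one positive degree, every `Ext(X, M)` with `X` finitely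
-- generated is killed by some scalar outside 𝔭.
--
-- Part 1: if `Extⁿ(G, M)` vanishes at 𝔭 for one n > 0, finite generation gives a single r ∉ 𝔭
-- killing it. Annihilators multiply along extensions, so a power of r kills `Extⁿ(K, M)` for `K` in
-- some |G|ₜ, and dimension shifting passes from a syzygy `K` to `X`. The scalar may depend on `X`,
-- so t need not be bounded.
--
-- Part 2: membership in `coca` needs one scalar for all `X`, hence the uniform level of a strong
-- generator. Kernels and cokernels shift the degree by one, so r must kill `Extⁱ(G, M)` on a whole
-- window of degrees, which shrinks at both ends with each level
-- (`AnnihilatesExt.exists_of_thickLevel`). A single surviving degree suffices, since dimension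
-- shifting reaches all higher ones.

universe w v' u'

open CategoryTheory Abelian Limits

/-! ### Localization of Ext -/

section LocalizationExt

variable {R : Type u} [CommRing R] (S : Submonoid R)

lemma ModuleCat.projective_localizedModuleFunctor_obj (X : ModuleCat.{u} R)
    [Module.Projective R X] : Projective ((ModuleCat.localizedModuleFunctor S).obj X) := by
  rw [← IsProjective.iff_projective]
  change Module.Projective (Localization S) (X.localizedModule S)
  exact Module.projective_of_isLocalizedModule S (X.localizedModuleMkLinearMap S)

/-- Any localization of a module is linearly equivalent to `ModuleCat.localizedModule`. -/
noncomputable def ModuleCat.localizedModuleEquiv (X : ModuleCat.{u} R) {Q : Type*}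
    [AddCommGroup Q] [Module R Q] [Module (Localization S) Q] [IsScalarTower R (Localization S) Q]
    (g : X →ₗ[R] Q) [IsLocalizedModule S g] : X.localizedModule S ≃ₗ[Localization S] Q :=
  LinearEquiv.extendScalarsOfIsLocalization S (Localization S)
    (IsLocalizedModule.linearEquiv S (X.localizedModuleMkLinearMap S) g)

lemma ModuleCat.localizedModuleFunctor_map_smul_id (M : ModuleCat.{u} R) (r : R) :
    (ModuleCat.localizedModuleFunctor S).map (r • 𝟙 M) =
      algebraMap R (Localization S) r • 𝟙 ((ModuleCat.localizedModuleFunctor S).obj M) := by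
  have h : IsLocalizedModule.mapExtendScalars S (M.localizedModuleMkLinearMap S)
      (M.localizedModuleMkLinearMap S) (Localization S) (r • LinearMap.id) =
      algebraMap R (Localization S) r • LinearMap.id := by
    rw [map_smul]
    ext x
    rw [LinearMap.smul_apply, LinearMap.smul_apply, algebraMap_smul]
    simp
  exact ModuleCat.hom_ext h

lemma mapExactFunctor_localizedModuleFunctor_smul {X M : ModuleCat.{u} R} {n : ℕ} (r : R)
    (e : Ext.{u} X M n) :
    (r • e).mapExactFunctor (ModuleCat.localizedModuleFunctor S) =
      algebraMap R (Localization S) r •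
        e.mapExactFunctor (ModuleCat.localizedModuleFunctor S) := by
  rw [Ext.smul_eq_comp_mk₀, Ext.mapExactFunctor_comp, Ext.mapExactFunctor_mk₀,
    ModuleCat.localizedModuleFunctor_map_smul_id, ← Ext.smul_eq_comp_mk₀]

/-- Over a Noetherian ring, `Extⁿ(X, M) → Extⁿ(X_S, M_S)` is a localization at `S` for `X` finitely
generated: its kernel is `S`-torsion, and it is surjective up to multiplication by `S`. -/
theorem exists_smul_eq_zero_and_exists_smul_eq_mapExactFunctor [IsNoetherianRing R]
    (X M : ModuleCat.{u} R) [Module.Finite R X] (n : ℕ) :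
    (∀ e : Ext.{u} X M n, e.mapExactFunctor (ModuleCat.localizedModuleFunctor S) = 0 →
      ∃ s ∈ S, s • e = 0) ∧
    (∀ y : Ext.{u} ((ModuleCat.localizedModuleFunctor S).obj X)
        ((ModuleCat.localizedModuleFunctor S).obj M) n,
      ∃ s ∈ S, ∃ e : Ext.{u} X M n,
        e.mapExactFunctor (ModuleCat.localizedModuleFunctor S) =
          algebraMap R (Localization S) s • y) := by
  induction n generalizing X with
  | zero =>
    -- Degree zero is Hom out of a finitely presented module, which commutes with localization.
    have := Module.finitePresentation_of_finite R X
    refine ⟨fun e he ↦ ?_, fun y ↦ ?_⟩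
    · obtain ⟨φ, rfl⟩ := (Ext.mk₀_bijective X M).2 e
      rw [Ext.mapExactFunctor_mk₀] at he
      have h0 : (ModuleCat.localizedModuleFunctor S).map φ = 0 :=
        (Ext.mk₀_bijective _ _).1 (by rw [he, Ext.mk₀_zero])
      obtain ⟨s, hs⟩ := IsLocalizedModule.exists_of_eq (S := S)
        (f := IsLocalizedModule.mapExtendScalars S (X.localizedModuleMkLinearMap S)
          (M.localizedModuleMkLinearMap S) (Localization S)) (x₁ := φ.hom) (x₂ := 0) (by
          rw [map_zero]
          exact congrArg ModuleCat.Hom.hom h0)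
      refine ⟨s, s.2, ?_⟩
      rw [← Ext.mk₀_smul, show (s : R) • φ = 0 from
        ModuleCat.hom_ext (hs.trans (smul_zero s)),
        Ext.mk₀_zero]
    · obtain ⟨ψ, rfl⟩ := (Ext.mk₀_bijective _ _).2 y
      obtain ⟨⟨φ, s⟩, hs⟩ := IsLocalizedModule.surj (S := S)
        (f := IsLocalizedModule.mapExtendScalars S (X.localizedModuleMkLinearMap S)
          (M.localizedModuleMkLinearMap S) (Localization S)) ψ.hom
      refine ⟨s, s.2, Ext.mk₀ (ModuleCat.ofHom φ), ?_⟩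
      rw [Ext.mapExactFunctor_mk₀, ← Ext.mk₀_smul]
      congr 1
      refine ModuleCat.hom_ext (hs.symm.trans ?_)
      refine LinearMap.ext fun x ↦ ?_
      exact (algebraMap_smul (M := M.localizedModule S) (Localization S) (s : R) (ψ.hom x)).symm
  | succ n ih =>
    obtain ⟨F, _, _, _, _, f, hf⟩ := Module.exists_finite_presentation R X
    have hS := LinearMap.shortExact_shortComplexKer hf
    have hSL := hS.map_of_exact (ModuleCat.localizedModuleFunctor S)
    have hproj : Projective ((ModuleCat.localizedModuleFunctor S).obj f.shortComplexKer.X₂) :=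
      ModuleCat.projective_localizedModuleFunctor_obj S _
    obtain ⟨ihK, ihK'⟩ := ih f.shortComplexKer.X₁
    obtain ⟨_, ihF'⟩ := ih f.shortComplexKer.X₂
    have hext := Ext.mapExactFunctor_extClass (ModuleCat.localizedModuleFunctor S) hS
    refine ⟨fun e he ↦ ?_, fun y ↦ ?_⟩
    · obtain ⟨e', rfl⟩ := precomp_extClass_surjective_of_projective_X₂ M hS n e
      change (hS.extClass.comp e' (add_comm 1 n)).mapExactFunctor _ = 0 at he
      change ∃ s ∈ S, s • hS.extClass.comp e' (add_comm 1 n) = 0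
      rw [Ext.mapExactFunctor_comp, hext] at he
      obtain ⟨g, hg⟩ := Ext.contravariant_sequence_exact₁ hSL _ _ _ he
      obtain ⟨s, hs, g', hg'⟩ := ihF' g
      -- The localization of `e'` is the restriction of `g`, and `g'` descends `g` up to s. The
      -- corrected class dies after localization, and the connecting map kills the correction.
      obtain ⟨t, ht, h⟩ := ihK (s • e' - (Ext.mk₀ f.shortComplexKer.f).comp g' (zero_add n)) (by
        rw [← Functor.mapExtAddHom_apply, map_sub, Functor.mapExtAddHom_apply,
          Functor.mapExtAddHom_apply, mapExactFunctor_localizedModuleFunctor_smul,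
          Ext.mapExactFunctor_comp, Ext.mapExactFunctor_mk₀, hg', sub_eq_zero, ← hg]
        exact (Ext.comp_smul ..).symm)
      refine ⟨t * s, mul_mem ht hs, ?_⟩
      rw [smul_sub, sub_eq_zero, smul_smul] at h
      rw [← Ext.comp_smul, h, Ext.comp_smul, hS.extClass_comp_assoc, smul_zero]
    · have : Projective (f.shortComplexKer.map (ModuleCat.localizedModuleFunctor S)).X₂ := hproj
      obtain ⟨y', rfl⟩ := precomp_extClass_surjective_of_projective_X₂ _ hSL n y
      obtain ⟨s, hs, e, he⟩ := ihK' y'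
      refine ⟨s, hs, hS.extClass.comp e (add_comm 1 n), ?_⟩
      rw [Ext.mapExactFunctor_comp, hext, he]
      exact Ext.comp_smul ..

theorem exists_smul_ext_eq_zero_of_hasInjectiveDimensionLT_localizedModule [IsNoetherianRing R]
    (X M : ModuleCat.{u} R) [Module.Finite R X] (n : ℕ)
    [HasInjectiveDimensionLT (M.localizedModule S) n] {i : ℕ} (hi : n ≤ i) (e : Ext.{u} X M i) :
    ∃ s ∈ S, s • e = 0 :=
  (exists_smul_eq_zero_and_exists_smul_eq_mapExactFunctor S X M i).1 e
    (Ext.eq_zero_of_hasInjectiveDimensionLT (X := M.localizedModule S) _ n hi)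

theorem subsingleton_ext_localizedModule [IsNoetherianRing R]
    (X M : ModuleCat.{u} R) [Module.Finite R X] (n : ℕ)
    (h : ∀ e : Ext.{u} X M n, ∃ s ∈ S, s • e = 0) :
    Subsingleton (Ext.{u} ((ModuleCat.localizedModuleFunctor S).obj X)
      ((ModuleCat.localizedModuleFunctor S).obj M) n) := by
  refine subsingleton_of_forall_eq 0 fun y ↦ ?_
  obtain ⟨s, hs, e, he⟩ :=
    (exists_smul_eq_zero_and_exists_smul_eq_mapExactFunctor S X M n).2 y
  obtain ⟨t, ht, hte⟩ := h e
  have key : algebraMap R (Localization S) (t * s) • y = 0 := by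
    rw [map_mul, mul_smul, ← he, ← mapExactFunctor_localizedModuleFunctor_smul, hte,
      Ext.mapExactFunctor_zero]
  obtain ⟨u, hu⟩ := IsLocalization.map_units (Localization S) (⟨t * s, mul_mem ht hs⟩ : S)
  change (u : Localization S) = algebraMap R (Localization S) (t * s) at hu
  rw [← hu] at key
  rw [← one_smul (Localization S) y, ← u.inv_mul, mul_smul, key, smul_zero]

end LocalizationExt

/-! ### Injective dimension tested on cyclic modules -/

section Baer

variable {A : Type u} [CommRing A]

/-- Baer's criterion for injective dimension. -/
theorem ModuleCat.hasInjectiveDimensionLE_of_subsingleton_ext_quotient (N : ModuleCat.{u} A)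
    (n : ℕ) (h : ∀ I : Ideal A, Subsingleton (Ext.{u} (ModuleCat.of A (A ⧸ I)) N (n + 1))) :
    HasInjectiveDimensionLE N n := by
  induction n generalizing N with
  | zero =>
    rw [HasInjectiveDimensionLE, zero_add, ← injective_iff_hasInjectiveDimensionLT_one,
      ← Module.injective_iff_injective_object, ← Module.Baer.iff_injective]
    intro I g
    have hT := ModuleCat.shortComplex_shortExact
      (ModuleCat.shortComplexOfCompEqZero I.subtype I.mkQ
        (LinearMap.exact_subtype_mkQ I).linearMap_comp_eq_zero)
      (LinearMap.exact_subtype_mkQ I) I.injective_subtype I.mkQ_surjective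
    obtain ⟨φ, hφ⟩ := Ext.contravariant_sequence_exact₁ hT N (Ext.mk₀ (ModuleCat.ofHom g))
      (add_zero 1) ((h I).elim _ _)
    obtain ⟨φ, rfl⟩ := (Ext.mk₀_bijective _ _).2 φ
    rw [Ext.mk₀_comp_mk₀] at hφ
    have := (Ext.mk₀_bijective _ _).1 hφ
    exact ⟨φ.hom, fun x hx ↦ congr($(this).hom ⟨x, hx⟩)⟩
  | succ n ih =>
    obtain ⟨I, _, f, _⟩ := EnoughInjectives.presentation N
    have hT : (ShortComplex.mk f (cokernel.π f) (cokernel.condition f)).ShortExact :=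
      { exact := ShortComplex.exact_cokernel f }
    rw [HasInjectiveDimensionLE, ← hT.hasInjectiveDimensionLT_X₃_iff n inferInstance]
    refine ih _ fun J ↦ subsingleton_of_forall_eq 0 fun x ↦ ?_
    obtain ⟨y, rfl⟩ := Ext.covariant_sequence_exact₃ _ hT x rfl ((h J).elim _ _)
    rw [Ext.eq_zero_of_injective y, Ext.zero_comp]

end Baer

theorem hasInjectiveDimensionLE_localizedModule {R : Type u} [CommRing R] [IsNoetherianRing R]
    (S : Submonoid R) (M : ModuleCat.{u} R) (n : ℕ)
    (h : ∀ X : ModuleCat.{u} R, Module.Finite R X →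
      ∀ e : Ext.{u} X M (n + 1), ∃ s ∈ S, s • e = 0) :
    HasInjectiveDimensionLE (M.localizedModule S) n := by
  refine ModuleCat.hasInjectiveDimensionLE_of_subsingleton_ext_quotient _ _ fun I ↦ ?_
  -- Every ideal of the localization is extended from R, so the cyclic test module is the
  -- localization of the finitely generated module `R ⧸ J`.
  obtain ⟨J, rfl⟩ : ∃ J : Ideal R,
      J.localized' (Localization S) S (Algebra.linearMap R (Localization S)) = I :=
    ⟨I.comap (algebraMap R (Localization S)), by
      simp [Ideal.localized'_eq_map, IsLocalization.map_under S]⟩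
  let X := ModuleCat.of R (R ⧸ J)
  have := subsingleton_ext_localizedModule S X M (n + 1) (h X inferInstance)
  let e := (ModuleCat.localizedModuleEquiv S X
    (J.toLocalizedQuotient' (Localization S) S (Algebra.linearMap R (Localization S)))).toModuleIso
  refine subsingleton_of_forall_eq 0 fun y ↦ ?_
  have hy : (Ext.mk₀ e.hom).comp y (zero_add _) = 0 := this.elim _ _
  rw [← Ext.mk₀_id_comp y, ← e.inv_hom_id, ← Ext.mk₀_comp_mk₀_assoc, hy, Ext.comp_zero]

/-! ### Annihilators of Ext along exact sequences -/

section Annihilation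

variable {R : Type u} [CommRing R] {C : Type u'} [Category.{v'} C] [Abelian C] [Linear R C]
  [HasExt.{w} C]

/-- The scalar `r` annihilates `Extⁱ(X, M)`. -/
def AnnihilatesExt (r : R) (X M : C) (i : ℕ) : Prop :=
  ∀ e : Ext.{w} X M i, r • e = 0

namespace AnnihilatesExt

variable {r r' : R} {X Y M : C} {i : ℕ}

lemma mul_left (h : AnnihilatesExt r X M i) (r' : R) : AnnihilatesExt (r' * r) X M i :=
  fun e ↦ by rw [mul_smul, h, smul_zero]

lemma mul_right (h : AnnihilatesExt r X M i) (r' : R) : AnnihilatesExt (r * r') X M i :=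
  mul_comm r' r ▸ h.mul_left r'

lemma of_isZero (r : R) (hX : IsZero X) : AnnihilatesExt r X M i := fun e ↦ by
  rw [← e.mk₀_id_comp, hX.eq_zero_of_src (𝟙 X), Ext.mk₀_zero, Ext.zero_comp, smul_zero]

lemma of_projective (r : R) [Projective X] : AnnihilatesExt r X M (i + 1) := fun e ↦ by
  rw [e.eq_zero_of_projective, smul_zero]

/-- If `𝟙 Y` is a finite sum of morphisms that factor through `X`, then the annihilator
of `Extⁱ(X, M)` annihilates `Extⁱ(Y, M)`. -/
lemma of_sum_comp_eq_id (h : AnnihilatesExt r X M i) {ι : Type*} [Fintype ι]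
    (f : ι → (Y ⟶ X)) (g : ι → (X ⟶ Y)) (hfg : ∑ j, f j ≫ g j = 𝟙 Y) :
    AnnihilatesExt r Y M i := fun e ↦ by
  rw [← e.mk₀_id_comp, ← hfg, Ext.mk₀_sum, Ext.sum_comp, Finset.smul_sum]
  refine Finset.sum_eq_zero fun j _ ↦ ?_
  rw [← Ext.mk₀_comp_mk₀_assoc, ← Ext.comp_smul, h, Ext.comp_zero]

lemma of_retract (h : AnnihilatesExt r X M i) (ρ : Retract Y X) : AnnihilatesExt r Y M i :=
  h.of_sum_comp_eq_id (ι := Unit) (fun _ ↦ ρ.i) (fun _ ↦ ρ.r) (by simp)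

variable {S : ShortComplex C}

/-- One scalar makes the image of the class in the next term of the long exact sequence vanish;
exactness lifts the multiple to the preceding term, where the other scalar kills it. The outer
positions work the same way. -/
lemma X₂_of_shortExact (hS : S.ShortExact) (h₁ : AnnihilatesExt r S.X₁ M i)
    (h₃ : AnnihilatesExt r' S.X₃ M i) : AnnihilatesExt (r * r') S.X₂ M i := fun e ↦ by
  obtain ⟨x, hx⟩ := Ext.contravariant_sequence_exact₂ hS M (r • e) (by rw [Ext.comp_smul, h₁])
  rw [mul_comm, mul_smul, ← hx, ← Ext.comp_smul, h₃, Ext.comp_zero]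

lemma X₁_of_shortExact (hS : S.ShortExact) (h₂ : AnnihilatesExt r S.X₂ M i)
    (h₃ : AnnihilatesExt r' S.X₃ M (i + 1)) : AnnihilatesExt (r * r') S.X₁ M i := fun e ↦ by
  obtain ⟨x, hx⟩ := Ext.contravariant_sequence_exact₁ hS M (r' • e) (add_comm 1 i)
    (by rw [Ext.comp_smul, h₃])
  rw [mul_smul, ← hx, ← Ext.comp_smul, h₂, Ext.comp_zero]

lemma X₃_of_shortExact (hS : S.ShortExact) (h₁ : AnnihilatesExt r S.X₁ M i)
    (h₂ : AnnihilatesExt r' S.X₂ M (i + 1)) : AnnihilatesExt (r * r') S.X₃ M (i + 1) := fun e ↦ by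
  obtain ⟨x, hx⟩ := Ext.contravariant_sequence_exact₃ hS M (r' • e) (by rw [Ext.comp_smul, h₂])
    (add_comm 1 i)
  rw [mul_smul, ← hx, ← Ext.comp_smul, h₁, Ext.comp_zero]

lemma X₃_of_projective (hS : S.ShortExact) [Projective S.X₂] (h₁ : AnnihilatesExt r S.X₁ M i) :
    AnnihilatesExt r S.X₃ M (i + 1) := by
  simpa using X₃_of_shortExact hS h₁ (of_projective (1 : R))

variable {D : Type*} [Category* D] [Abelian D] (F : D ⥤ C) [F.Additive]

lemma of_addClosure {G Y : D} (hY : addClosure G Y) (h : AnnihilatesExt r (F.obj G) M i) :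
    AnnihilatesExt r (F.obj Y) M i := by
  have := Abelian.hasFiniteBiproducts (C := D)
  obtain ⟨k, ⟨ρ⟩⟩ := hY
  refine AnnihilatesExt.of_retract ?_ (ρ.map F)
  refine h.of_sum_comp_eq_id (fun j ↦ F.map (biproduct.π _ j))
    (fun j ↦ F.map (biproduct.ι (fun _ : Fin k ↦ G) j)) ?_
  simp_rw [← F.map_comp, ← F.map_sum, biproduct.total, F.map_id]

variable [PreservesFiniteLimits F] [PreservesFiniteColimits F] {G : D}

/-- Scalars annihilating `Extⁱ(G, M)` annihilate `Extⁱ(Y, M)` up to powers for `Y` in `|G|ₜ`. -/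
theorem exists_of_extLevel {s : Submonoid R} (hr : r ∈ s)
    (h : AnnihilatesExt r (F.obj G) M i) (t : ℕ) :
    ∀ Y : D, extLevel G t Y → ∃ r' ∈ s, AnnihilatesExt r' (F.obj Y) M i := by
  induction t with
  | zero => exact fun Y hY ↦ ⟨1, one_mem s, of_isZero _ (F.map_isZero hY)⟩
  | succ t ih =>
    cases t with
    | zero => exact fun Y hY ↦ ⟨r, hr, of_addClosure F hY h⟩
    | succ t =>
      rintro Y ⟨S, hS, h₁, ⟨ρ⟩, h₃⟩
      obtain ⟨r₁, hr₁, h₁⟩ := ih _ h₁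
      exact ⟨r₁ * r, mul_mem hr₁ hr, (X₂_of_shortExact (hS.map_of_exact F) h₁
        (of_addClosure F h₃ h)).of_retract (ρ.map F)⟩

/-- If `r` annihilates `Extⁱ(G, M)` for `a ≤ i ≤ b`, then one power of `r` annihilates `Extⁱ(Y, M)`
for all `Y` in `thickⁿ(G)` and `a + n ≤ i ≤ b - n`. -/
theorem exists_of_thickLevel {s : Submonoid R} (hr : r ∈ s) {a b : ℕ}
    (h : ∀ i, a ≤ i → i ≤ b → AnnihilatesExt r (F.obj G) M i) (n : ℕ) :
    ∃ r' ∈ s, ∀ Y : D, thickLevel G n Y → ∀ i, a + n ≤ i → i + n ≤ b →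
      AnnihilatesExt r' (F.obj Y) M i := by
  induction n with
  | zero => exact ⟨1, one_mem s, fun Y hY _ _ _ ↦ of_isZero _ (F.map_isZero hY)⟩
  | succ n ih =>
    cases n with
    | zero =>
      exact ⟨r, hr, fun Y hY i hi hi' ↦ of_addClosure F hY (h i (by lia) (by lia))⟩
    | succ n =>
      obtain ⟨r', hr', h'⟩ := ih
      -- Whichever term lies in the lower level, the product of the two scalars is the same, so one
      -- scalar serves every `Y`.
      have key (A B : D) (hAB : OneInEach (thickLevel G (n + 1)) (addClosure G) A B) :
          ∃ c d : R, c * d = r' * r ∧ ∀ i, a + (n + 1) ≤ i → i + (n + 1) ≤ b →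
            AnnihilatesExt c (F.obj A) M i ∧ AnnihilatesExt d (F.obj B) M i := by
        obtain ⟨hA, hB⟩ | ⟨hA, hB⟩ := hAB
        · exact ⟨r', r, rfl, fun i hi hi' ↦ ⟨h' A hA i hi hi',
            of_addClosure F hB (h i (by lia) (by lia))⟩⟩
        · exact ⟨r, r', mul_comm _ _, fun i hi hi' ↦
            ⟨of_addClosure F hA (h i (by lia) (by lia)), h' B hB i hi hi'⟩⟩
      refine ⟨r' * r, mul_mem hr' hr, ?_⟩
      rintro Y ⟨S, hS, ⟨⟨ρ⟩, hAB⟩ | ⟨⟨ρ⟩, hAB⟩ | ⟨⟨ρ⟩, hAB⟩⟩ i hi hi' <;>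
        obtain ⟨c, d, hcd, hAB⟩ := key _ _ hAB <;>
        refine AnnihilatesExt.of_retract ?_ (ρ.map F) <;> rw [← hcd]
      · exact X₁_of_shortExact (hS.map_of_exact F) (hAB i (by lia) (by lia)).1
          (hAB (i + 1) (by lia) (by lia)).2
      · exact X₂_of_shortExact (hS.map_of_exact F) (hAB i (by lia) (by lia)).1
          (hAB i (by lia) (by lia)).2
      -- The third position uses the degree below, as the first uses the degree above: hence the
      -- loss at both ends of the window.
      · obtain ⟨i, rfl⟩ : ∃ j, i = j + 1 := ⟨i - 1, by lia⟩
        exact X₃_of_shortExact (hS.map_of_exact F) (hAB i (by lia) (by lia)).1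
          (hAB (i + 1) (by lia) (by lia)).2

end AnnihilatesExt

end Annihilation

/-! ### The infinite injective dimension locus -/

section Modules

variable {R : Type u} [CommRing R] (M : Type u) [AddCommGroup M] [Module R M]

lemma notMem_infiniteInjDimLocus_iff (p : PrimeSpectrum R) :
    p ∉ infiniteInjDimLocus R M ↔ ∃ n : ℕ, HasInjectiveDimensionLE
      ((ModuleCat.of R M).localizedModule p.asIdeal.primeCompl) n := by
  rw [← injectiveDimension_ne_top_iff, ModuleCat.injectiveDimension_eq_of_linearEquiv
    (ModuleCat.localizedModuleEquiv p.asIdeal.primeCompl (ModuleCat.of R M)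
      (LocalizedModule.mkLinearMap p.asIdeal.primeCompl M) :
      _ ≃ₗ[_] ModuleCat.of _ (LocalizedModule.AtPrime p.asIdeal M))]
  rfl

variable [IsNoetherianRing R]

/-- Dimension shifting along an `s`-th syzygy. -/
theorem AnnihilatesExt.of_isSyzygy {r : R} {M : ModuleCat.{u} R} {n : ℕ} (s : ℕ) :
    ∀ (X K : FGModuleCat.{u} R), FGModuleCat.IsSyzygy s X K →
      AnnihilatesExt.{u} r K.obj M n → AnnihilatesExt.{u} r X.obj M (n + s) := by
  let F := forget₂ (FGModuleCat.{u} R) (ModuleCat.{u} R)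
  induction s with
  | zero => exact fun X K ⟨e⟩ h ↦ h.of_retract ((Retract.ofIso e).map F)
  | succ s ih =>
    rintro X K ⟨S, hS, ⟨e⟩, hP, hK⟩ h
    have hS' := hS.map_of_exact F
    have : Projective (S.map F).X₂ := (IsProjective.iff_projective _).1 hP
    have := AnnihilatesExt.X₃_of_projective hS' (ih _ _ hK h)
    exact this.of_retract ((Retract.ofIso e.symm).map F)

/-- Dimension shifting: the hypothesis also covers first syzygies, so the same scalar works one
degree higher. -/
theorem AnnihilatesExt.of_forall_finite {r : R} {M : ModuleCat.{u} R} {n : ℕ}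
    (h : ∀ X : FGModuleCat.{u} R, AnnihilatesExt.{u} r X.obj M n) (k : ℕ) :
    ∀ X : FGModuleCat.{u} R, AnnihilatesExt.{u} r X.obj M (n + k) := by
  induction k with
  | zero => exact h
  | succ k ih =>
    intro X
    obtain ⟨P, _, _, _, _, f, hf⟩ := Module.exists_finite_presentation R X
    have hS := LinearMap.shortExact_shortComplexKer hf
    have : Projective f.shortComplexKer.X₂ := (IsProjective.iff_projective _).1
      (inferInstanceAs (Module.Projective R P))
    exact AnnihilatesExt.X₃_of_projective hS (ih (FGModuleCat.of R (LinearMap.ker f)))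

/-- The Ext module is finitely generated; multiply the scalars that kill its generators. -/
lemma exists_annihilatesExt_of_forall_exists {s : Submonoid R} {X M : ModuleCat.{u} R}
    [Module.Finite R X] [Module.Finite R M] {i : ℕ}
    (h : ∀ e : Ext.{u} X M i, ∃ r ∈ s, r • e = 0) : ∃ r ∈ s, AnnihilatesExt.{u} r X M i := by
  obtain ⟨T, hT⟩ := (ModuleCat.finite_ext R X M i).fg_top
  choose f hf hf' using h
  refine ⟨∏ e ∈ T, f e, prod_mem fun e _ ↦ hf e, fun e ↦ ?_⟩
  have : e ∈ Submodule.span R (T : Set (Ext.{u} X M i)) := hT ▸ Submodule.mem_top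
  induction this using Submodule.span_induction with
  | mem x hx =>
    classical
    rw [← Finset.prod_erase_mul _ _ hx, mul_smul, hf', smul_zero]
  | zero => rw [smul_zero]
  | add x y _ _ hx hy => rw [smul_add, hx, hy, add_zero]
  | smul a x _ hx => rw [smul_comm, hx, smul_zero]

lemma notMem_infiniteInjDimLocus_of_forall (p : PrimeSpectrum R) (n : ℕ)
    (h : ∀ X : FGModuleCat.{u} R, ∃ r ∈ p.asIdeal.primeCompl,
      AnnihilatesExt.{u} r X.obj (ModuleCat.of R M) (n + 1)) : p ∉ infiniteInjDimLocus R M := by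
  rw [notMem_infiniteInjDimLocus_iff]
  refine ⟨n, hasInjectiveDimensionLE_localizedModule _ _ _ fun X _ e ↦ ?_⟩
  obtain ⟨r, hr, h⟩ := h (FGModuleCat.of R X)
  exact ⟨r, hr, h e⟩

theorem infiniteInjDimLocus_subset_zeroLocus_coca :
    infiniteInjDimLocus R M ⊆ PrimeSpectrum.zeroLocus (coca R M : Set R) := by
  intro p hp r hr
  by_contra hrp
  obtain ⟨n, hn⟩ := (mem_coca R M r).1 hr
  exact notMem_infiniteInjDimLocus_of_forall M p n
    (fun X ↦ ⟨r, hrp, hn (n + 1) n.le_succ X⟩) hp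

variable [Module.Finite R M]

theorem infiniteInjDimLocus_eq_iInter_support {G : FGModuleCat.{u} R}
    (hG : G.IsExtensionGenerator) :
    infiniteInjDimLocus R M = ⋂ n : ℕ, ⋂ _ : 0 < n,
      Module.support R (Ext.{u} G.obj (ModuleCat.of R M) n) := by
  ext p
  rw [← not_iff_not, Set.mem_iInter₂]
  push Not
  constructor
  · rw [notMem_infiniteInjDimLocus_iff]
    rintro ⟨n, hn⟩
    refine ⟨n + 1, n.succ_pos, Module.notMem_support_iff'.2 fun e ↦ ?_⟩
    exact exists_smul_ext_eq_zero_of_hasInjectiveDimensionLT_localizedModule p.asIdeal.primeCompl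
      G.obj (ModuleCat.of R M) (n + 1) le_rfl e
  · rintro ⟨n, hn, hp⟩
    obtain ⟨r, hr, h⟩ := exists_annihilatesExt_of_forall_exists (s := p.asIdeal.primeCompl)
      (Module.notMem_support_iff'.1 hp)
    obtain ⟨n, rfl⟩ : ∃ m, n = m + 1 := ⟨n - 1, by lia⟩
    obtain ⟨s, hs⟩ := hG
    refine notMem_infiniteInjDimLocus_of_forall M p (n + s) fun X ↦ ?_
    obtain ⟨K, hK, t, ht⟩ := hs X
    obtain ⟨r', hr', h'⟩ := AnnihilatesExt.exists_of_extLevel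
      (forget₂ (FGModuleCat.{u} R) (ModuleCat.{u} R)) hr h t K ht
    exact ⟨r', hr', add_right_comm n 1 s ▸ AnnihilatesExt.of_isSyzygy s X K hK h'⟩

theorem isClosed_infiniteInjDimLocus {G : FGModuleCat.{u} R} (hG : G.IsExtensionGenerator) :
    IsClosed (infiniteInjDimLocus R M) := by
  rw [infiniteInjDimLocus_eq_iInter_support M hG]
  refine isClosed_iInter fun n ↦ isClosed_iInter fun _ ↦ ?_
  rw [Module.support_eq_zeroLocus]
  exact PrimeSpectrum.isClosed_zeroLocus _

theorem zeroLocus_coca_subset_infiniteInjDimLocus {G : FGModuleCat.{u} R}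
    (hG : IsAbelianStrongGenerator G) :
    PrimeSpectrum.zeroLocus (coca R M : Set R) ⊆ infiniteInjDimLocus R M := by
  intro p hp
  by_contra hpM
  obtain ⟨m, hm⟩ := (notMem_infiniteInjDimLocus_iff M p).1 hpM
  obtain ⟨n, hn⟩ := hG
  have hi (i : ℕ) (hi : m + 1 ≤ i) : ∃ r ∈ p.asIdeal.primeCompl,
      AnnihilatesExt.{u} r G.obj (ModuleCat.of R M) i :=
    exists_annihilatesExt_of_forall_exists fun e ↦
      exists_smul_ext_eq_zero_of_hasInjectiveDimensionLT_localizedModule p.asIdeal.primeCompl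
        G.obj (ModuleCat.of R M) (m + 1) hi e
  -- The scalar from `hi` depends on the degree, and a product handles only finitely many degrees at
  -- once.
  have hb (b : ℕ) : ∃ r ∈ p.asIdeal.primeCompl, ∀ i, m + 1 ≤ i → i ≤ m + 1 + b →
      AnnihilatesExt.{u} r G.obj (ModuleCat.of R M) i := by
    induction b with
    | zero =>
      obtain ⟨r, hr, h⟩ := hi (m + 1) le_rfl
      exact ⟨r, hr, fun i h₁ h₂ ↦ le_antisymm h₁ h₂ ▸ h⟩
    | succ b ih =>
      obtain ⟨r, hr, h⟩ := ih
      obtain ⟨r', hr', h'⟩ := hi (m + 1 + (b + 1)) (by lia)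
      refine ⟨r * r', mul_mem hr hr', fun i h₁ h₂ ↦ ?_⟩
      obtain h₂ | rfl := h₂.lt_or_eq
      · exact (h i h₁ (by lia)).mul_right r'
      · exact h'.mul_left r
  -- Level n costs n degrees at each end, so a window of length 2n leaves exactly degree m + 1 + n.
  obtain ⟨r, hr, h⟩ := hb (n + n)
  obtain ⟨r', hr', h'⟩ := AnnihilatesExt.exists_of_thickLevel
    (forget₂ (FGModuleCat.{u} R) (ModuleCat.{u} R)) hr h n
  refine hr' (hp ((mem_coca R M r').2 ⟨m + 1 + n, fun i hi X ↦ ?_⟩))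
  obtain ⟨k, rfl⟩ := Nat.exists_eq_add_of_le hi
  exact AnnihilatesExt.of_forall_finite
    (fun Y ↦ h' Y (hn Y) (m + 1 + n) le_rfl (by lia)) k X

end Modules

theorem mainTheorem4 (R : Type u) [CommRing R] [IsNoetherianRing R]
    (M : Type u) [AddCommGroup M] [Module R M] [Module.Finite R M] :
    ((∃ G : FGModuleCat.{u} R, G.IsExtensionGenerator) → IsClosed (infiniteInjDimLocus R M)) ∧
    (∀ G : FGModuleCat.{u} R, G.IsExtensionGenerator →
      infiniteInjDimLocus R M = ⋂ n : ℕ, ⋂ _ : 0 < n,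
        Module.support R (CategoryTheory.Abelian.Ext.{u} G.obj (ModuleCat.of R M) n)) ∧
    ((∃ G : FGModuleCat.{u} R, CategoryTheory.IsAbelianStrongGenerator G) →
      infiniteInjDimLocus R M = PrimeSpectrum.zeroLocus (coca R M : Set R)) :=
  ⟨fun ⟨_, hG⟩ ↦ isClosed_infiniteInjDimLocus M hG,
    fun _ hG ↦ infiniteInjDimLocus_eq_iInter_support M hG,
    fun ⟨_, hG⟩ ↦ (infiniteInjDimLocus_subset_zeroLocus_coca M).antisymm
      (zeroLocus_coca_subset_infiniteInjDimLocus M hG)⟩
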